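/- Let $\mathsf{Pos}$ be the category of posets and monotone maps, and let $T:\mathsf{Pos}\to\mathsf{Pos}$ be a functor that is finitary (preserves filtered colimits), locally monotone ($f\le g$ pointwise implies $Tf\le Tg$ pointwise), and preserves exact squares and finite intersections of order embeddings. Here a square $p_0:P\to A$, $p_1:P\to B$, $f:A\to C$, $g:B\to C$ with $f p_0\le g p_1$ is exact if $f(a)\le g(b)$ implies that there is $w\in P$ with $a\le p_0(w)$ and $p_1(w)\le b$. A monotone relation $R$ from $X$ to $Y$ is a relation with $R(y,x)$, $y'\le y$, $x\le x'$ implying $R(y',x')$. Its lifting $\bar T R$ from $TX$ to $TY$ is given by: $\bar TR(\beta,\alpha)$ iff there is $w\in TR$ with $\beta\le Tp_0(w)$ and $Tp_1(w)\le\alpha$, where $R\subseteq Y\times X$ carries the product order and $p_0,p_1$ are its projections to $Y$ and $X$. Let $T^\partial X=(TX^{op})^{op}$, and let $\mathbb U_\omega X$ and $\mathbb L_\omega X$ be the posets of finitely generated uppersets of $X$ (ordered by reversed inclusion) and finitely generated lowersets of $X$ (ordered by inclusion). Fix a poset $\mathsf{At}$ of atoms. The language $\mathcal L$ is the algebra for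 $\mathbb U_\omega+\mathbb L_\omega+T^\partial$ free on $\mathsf{At}$, with operations $\bigwedge:\mathbb U_\omega\mathcal L\to\mathcal L$, $\bigvee:\mathbb L_\omega\mathcal L\to\mathcal L$, $\nabla:T^\partial\mathcal L\to\mathcal L$. A pointed model $(c,\Vdash_c,x_0)$ consists of a monotone map $c:X\to TX$, a monotone valuation (a relation $x\Vdash_c p$ between $x\in X$ and $p\in\mathsf{At}$ that is preserved when $x$ or $p$ increases), and a point $x_0\in X$. Satisfaction extends the valuation to $\mathcal L$: $x\Vdash_c\bigwedge\phi$ iff $x\Vdash_c a$ for all $a\in\phi$; $x\Vdash_c\bigvee\psi$ iff $x\Vdash_c a$ for some $a\in\psi$; $x\Vdash_c\nabla\alpha$ iff $c(x)$ is related to $\alpha$ by $\overline{T^\partial}{\Vdash_c}$, where $\Vdash_c$ is seen as a monotone relation from $\mathcal L$ to $X^{op}$. Given pointed models $(c,\Vdash_c,x_0)$ on $X$ and $(d,\Vdash_d,y_0)$ on $Y$, a $T$-simulation from $(d,\Vdash_d,y_0)$ to $(c,\Vdash_c,x_0)$ is a monotone relation $S$ from $Y$ to $X$ such that (a) $S(x_0,y_0)$;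 (b) $S(x,y)$ implies $\bar TS(c(x),d(y))$; (c) if $S(x,y)$ and $x\Vdash_c p$ then $y\Vdash_d p$, for all $p\in\mathsf{At}$. If such an $S$ exists, $(d,\Vdash_d,y_0)$ simulates $(c,\Vdash_c,x_0)$. We say that $(d,\Vdash_d,y)$ is modally stronger than $(c,\Vdash_c,x)$ if $x\Vdash_c a$ implies $y\Vdash_d a$ for every $a\in\mathcal L$. Then the language $\mathcal L$ is 1. adequate: if $(d,\Vdash_d,y_0)$ simulates $(c,\Vdash_c,x_0)$, then $(d,\Vdash_d,y_0)$ is modally stronger than $(c,\Vdash_c,x_0)$; and 2. expressive: if $(d,\Vdash_d,y_0)$ is modally stronger than $(c,\Vdash_c,x_0)$, then $(d,\Vdash_d,y_0)$ simulates $(c,\Vdash_c,x_0)$; moreover, the relation $\{(x,y) : (d,\Vdash_d,y)\text{ is modally stronger than }(c,\Vdash_c,x)\}$ is a $T$-simulation from $(d,\Vdash_d,y_0)$ to $(c,\Vdash_c,x_0)$. -/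

import Mathlib

open CategoryTheory Limits OrderDual

universe u

namespace NablaLogic

/-! ### Conditions on endofunctors of the category of posets -/

/-- `T` is locally monotone: `f ≤ g` pointwise implies `T f ≤ T g` pointwise. -/
def LocallyMonotone (T : PartOrd.{u} ⥤ PartOrd.{u}) : Prop :=
  ∀ ⦃X Y : PartOrd.{u}⦄ (f g : X ⟶ Y), (∀ x : X, f x ≤ g x) →
    ∀ t : T.obj X, T.map f t ≤ T.map g t

/-- The lax square `f ∘ p₀ ≤ g ∘ p₁` is exact. -/
def IsExactSquare {P A B C : PartOrd.{u}} (p₀ : P ⟶ A) (p₁ : P ⟶ B) (f : A ⟶ C) (g : B ⟶ C) :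
    Prop :=
  (∀ w : P, f (p₀ w) ≤ g (p₁ w)) ∧
    ∀ (a : A) (b : B), f a ≤ g b → ∃ w : P, a ≤ p₀ w ∧ p₁ w ≤ b

/-- `T` preserves exact squares (the Beck-Chevalley Condition). -/
def PreservesExactSquares (T : PartOrd.{u} ⥤ PartOrd.{u}) : Prop :=
  ∀ ⦃P A B C : PartOrd.{u}⦄ (p₀ : P ⟶ A) (p₁ : P ⟶ B) (f : A ⟶ C) (g : B ⟶ C),
    IsExactSquare p₀ p₁ f g → IsExactSquare (T.map p₀) (T.map p₁) (T.map f) (T.map g)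

/-- A monotone map is an order embedding. -/
def IsOrderEmbedding {X Y : PartOrd.{u}} (m : X ⟶ Y) : Prop :=
  ∀ a b : X, m a ≤ m b ↔ a ≤ b

/-- `T` preserves finite intersections of order embeddings: pullbacks of two order embeddings
are sent to pullbacks (the nullary case, an identity, is preserved by every functor). -/
def PreservesFiniteIntersections (T : PartOrd.{u} ⥤ PartOrd.{u}) : Prop :=
  ∀ ⦃P A B X : PartOrd.{u}⦄ (i : P ⟶ A) (j : P ⟶ B) (m : A ⟶ X) (n : B ⟶ X),
    IsOrderEmbedding m → IsOrderEmbedding n → IsPullback i j m n →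
      IsPullback (T.map i) (T.map j) (T.map m) (T.map n)

/-! ### The functors that serve as arities -/

/-- The dual functor: `X ↦ (T Xᵒᵖ)ᵒᵖ`. -/
def dualFunctor (T : PartOrd.{u} ⥤ PartOrd.{u}) : PartOrd.{u} ⥤ PartOrd.{u} :=
  PartOrd.dual ⋙ T ⋙ PartOrd.dual

/-- Finitely generated lowersets, ordered by inclusion. -/
abbrev FinLower (X : Type u) [PartialOrder X] : Type u :=
  {l : LowerSet X // ∃ A : Set X, A.Finite ∧ lowerClosure A = l}

/-- Finitely generated uppersets, ordered by reversed inclusion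
(which is the order of `UpperSet`). -/
abbrev FinUpper (X : Type u) [PartialOrder X] : Type u :=
  {v : UpperSet X // ∃ A : Set X, A.Finite ∧ upperClosure A = v}

lemma lowerClosure_image_lowerClosure {X Y : Type u} [PartialOrder X] [PartialOrder Y]
    (f : X →o Y) (A : Set X) :
    lowerClosure (f '' (lowerClosure A : Set X)) = lowerClosure (f '' A) := by
  apply le_antisymm
  · rw [lowerClosure_le]
    rintro _ ⟨x, ⟨a, ha, hxa⟩, rfl⟩
    exact ⟨f a, ⟨a, ha, rfl⟩, f.monotone hxa⟩
  · exact lowerClosure_mono (Set.image_mono subset_lowerClosure)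

lemma upperClosure_image_upperClosure {X Y : Type u} [PartialOrder X] [PartialOrder Y]
    (f : X →o Y) (A : Set X) :
    upperClosure (f '' (upperClosure A : Set X)) = upperClosure (f '' A) := by
  apply le_antisymm
  · exact upperClosure_anti (Set.image_mono subset_upperClosure)
  · rw [le_upperClosure]
    rintro _ ⟨x, ⟨a, ha, hxa⟩, rfl⟩
    exact ⟨f a, ⟨a, ha, rfl⟩, f.monotone hxa⟩

/-- The action `l ↦ ↓ f[l]`. -/
def FinLower.map {X Y : Type u} [PartialOrder X] [PartialOrder Y] (f : X →o Y) :
    FinLower X →o FinLower Y where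
  toFun l := ⟨lowerClosure (f '' (l.1 : Set X)), by
    obtain ⟨A, hA, h⟩ := l.2
    exact ⟨f '' A, hA.image f, by rw [← h, lowerClosure_image_lowerClosure]⟩⟩
  monotone' _ _ h := lowerClosure_mono (Set.image_mono h)

/-- The action `v ↦ ↑ f[v]`. -/
def FinUpper.map {X Y : Type u} [PartialOrder X] [PartialOrder Y] (f : X →o Y) :
    FinUpper X →o FinUpper Y where
  toFun v := ⟨upperClosure (f '' (v.1 : Set X)), by
    obtain ⟨A, hA, h⟩ := v.2
    exact ⟨f '' A, hA.image f, by rw [← h, upperClosure_image_upperClosure]⟩⟩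
  monotone' _ _ h := upperClosure_anti (Set.image_mono h)

/-- The finitary lowerset functor. -/
def lowerFunctor : PartOrd.{u} ⥤ PartOrd.{u} where
  obj X := PartOrd.of (FinLower X)
  map f := PartOrd.ofHom (FinLower.map f.hom)
  map_id X := by
    refine PartOrd.ext fun l => Subtype.ext ?_
    change lowerClosure (_ '' (l.1 : Set X)) = l.1
    simp
  map_comp f g := by
    refine PartOrd.ext fun l => Subtype.ext ?_
    change lowerClosure _ = lowerClosure (g.hom '' (lowerClosure (f.hom '' (l.1 : Set _)) : Set _))
    rw [lowerClosure_image_lowerClosure, ← Set.image_comp]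
    rfl

/-- The finitary upperset functor. -/
def upperFunctor : PartOrd.{u} ⥤ PartOrd.{u} where
  obj X := PartOrd.of (FinUpper X)
  map f := PartOrd.ofHom (FinUpper.map f.hom)
  map_id X := by
    refine PartOrd.ext fun l => Subtype.ext ?_
    change upperClosure (_ '' (l.1 : Set X)) = l.1
    simp
  map_comp f g := by
    refine PartOrd.ext fun l => Subtype.ext ?_
    change upperClosure _ = upperClosure (g.hom '' (upperClosure (f.hom '' (l.1 : Set _)) : Set _))
    rw [upperClosure_image_upperClosure, ← Set.image_comp]
    rfl

lemma monotone_sumMap {A B C D : Type u} [PartialOrder A] [PartialOrder B] [PartialOrder C]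
    [PartialOrder D] (f : A →o C) (g : B →o D) : Monotone (Sum.map f g) := by
  rintro _ _ (h | h)
  · exact Sum.inl_le_inl_iff.2 (f.monotone h)
  · exact Sum.inr_le_inr_iff.2 (g.monotone h)

lemma monotone_sumElim {A B C : Type u} [PartialOrder A] [PartialOrder B] [PartialOrder C]
    (f : A →o C) (g : B →o C) : Monotone (Sum.elim f g) := by
  rintro _ _ (h | h)
  · exact f.monotone h
  · exact g.monotone h

/-- The pointwise coproduct (disjoint union) of two endofunctors. -/
def sumFunctor (F G : PartOrd.{u} ⥤ PartOrd.{u}) : PartOrd.{u} ⥤ PartOrd.{u} where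
  obj X := PartOrd.of (F.obj X ⊕ G.obj X)
  map f := PartOrd.ofHom ⟨Sum.map (F.map f).hom (G.map f).hom, monotone_sumMap _ _⟩
  map_id X := by
    ext (x | x) <;> simp
  map_comp f g := by
    ext (x | x) <;> simp

/-- The functor `X ↦ ((𝕌_ω X + 𝕃_ω X) + T^∂ X) + At`. Its initial algebra is the free
`(𝕌_ω + 𝕃_ω + T^∂)`-algebra on `At`. -/
def langFunctor (T : PartOrd.{u} ⥤ PartOrd.{u}) (At : PartOrd.{u}) : PartOrd.{u} ⥤ PartOrd.{u} :=
  sumFunctor (sumFunctor (sumFunctor upperFunctor lowerFunctor) (dualFunctor T))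
    ((Functor.const _).obj At)

/-! ### Existence of the free algebra -/

/-- An elementary description of colimits of sequences of posets. -/
def IsSeqColim {D : ℕ ⥤ PartOrd.{u}} (c : Cocone D) : Prop :=
  (∀ x : c.pt, ∃ (n : ℕ) (a : D.obj n), c.ι.app n a = x) ∧
    ∀ (n : ℕ) (a b : D.obj n), c.ι.app n a ≤ c.ι.app n b →
      ∃ (m : ℕ) (h : n ⟶ m), D.map h a ≤ D.map h b

lemma cocone_app {D : ℕ ⥤ PartOrd.{u}} (c : Cocone D) {n m : ℕ} (h : n ⟶ m) (a : D.obj n) :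
    c.ι.app m (D.map h a) = c.ι.app n a := by
  rw [← c.w h]; rfl

lemma map_map_app (F : ℕ ⥤ PartOrd.{u}) {i j k : ℕ} (f : i ⟶ j) (g : j ⟶ k) (h : i ⟶ k)
    (a : F.obj i) : F.map g (F.map f a) = F.map h a := by
  rw [Subsingleton.elim h (f ≫ g), F.map_comp]; rfl

lemma IsSeqColim.le {D : ℕ ⥤ PartOrd.{u}} {c : Cocone D} (hc : IsSeqColim c) (s : Cocone D)
    {n m : ℕ} (a : D.obj n) (b : D.obj m) (h : c.ι.app n a ≤ c.ι.app m b) :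
    s.ι.app n a ≤ s.ι.app m b := by
  rw [← cocone_app c (homOfLE (le_max_left n m)), ← cocone_app c (homOfLE (le_max_right n m))] at h
  obtain ⟨k, hk, hle⟩ := hc.2 _ _ _ h
  have := (s.ι.app k).hom.monotone hle
  erw [cocone_app s hk, cocone_app s hk] at this
  rw [cocone_app s, cocone_app s] at this
  exact this

/-- The mediating map out of a cocone satisfying `IsSeqColim`. -/
noncomputable def IsSeqColim.desc {D : ℕ ⥤ PartOrd.{u}} {c : Cocone D} (hc : IsSeqColim c)
    (s : Cocone D) : c.pt ⟶ s.pt :=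
  PartOrd.ofHom
    { toFun := fun x => s.ι.app (hc.1 x).choose (hc.1 x).choose_spec.choose
      monotone' := fun x y hxy => hc.le s _ _ (by
        rw [(hc.1 x).choose_spec.choose_spec, (hc.1 y).choose_spec.choose_spec]; exact hxy) }

lemma IsSeqColim.fac {D : ℕ ⥤ PartOrd.{u}} {c : Cocone D} (hc : IsSeqColim c)
    (s : Cocone D) (n : ℕ) : c.ι.app n ≫ hc.desc s = s.ι.app n := by
  ext a
  have h := (hc.1 (c.ι.app n a)).choose_spec.choose_spec
  exact le_antisymm (hc.le s _ _ h.le) (hc.le s _ _ h.ge)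

lemma IsSeqColim.isColimit {D : ℕ ⥤ PartOrd.{u}} {c : Cocone D} (hc : IsSeqColim c) :
    Nonempty (IsColimit c) :=
  ⟨{ desc := fun s => hc.desc s
     fac := fun s n => hc.fac s n
     uniq := fun s f hf => by
      ext x
      obtain ⟨n, a, rfl⟩ := hc.1 x
      exact (ConcreteCategory.congr_hom (hf n) a).trans
        (ConcreteCategory.congr_hom (hc.fac s n) a).symm }⟩

/-- The preorder of germs of a sequence of posets. -/
def Germ (D : ℕ ⥤ PartOrd.{u}) : Type u := Σ n : ℕ, D.obj n

instance (D : ℕ ⥤ PartOrd.{u}) : Preorder (Germ D) where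
  le p q := ∃ (k : ℕ) (hp : p.1 ⟶ k) (hq : q.1 ⟶ k), D.map hp p.2 ≤ D.map hq q.2
  le_refl p := ⟨p.1, 𝟙 _, 𝟙 _, le_rfl⟩
  le_trans p q r := by
    rintro ⟨k, hp, hq, h⟩ ⟨l, hq', hr, h'⟩
    let ik : k ⟶ max k l := homOfLE (le_max_left k l)
    let il : l ⟶ max k l := homOfLE (le_max_right k l)
    refine ⟨max k l, hp ≫ ik, hr ≫ il, ?_⟩
    have h1 := (D.map ik).hom.monotone h
    have h2 := (D.map il).hom.monotone h'
    rw [← map_map_app D hp ik, ← map_map_app D hr il]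
    refine le_trans h1 (le_trans (le_of_eq ?_) h2)
    exact (map_map_app D hq ik (hq ≫ ik) q.2).trans (map_map_app D hq' il (hq ≫ ik) q.2).symm

/-- The standard colimit cocone of a sequence of posets. -/
def seqCocone (D : ℕ ⥤ PartOrd.{u}) : Cocone D where
  pt := PartOrd.of (Antisymmetrization (Germ D) (· ≤ ·))
  ι :=
    { app := fun n => PartOrd.ofHom
        { toFun := fun a => toAntisymmetrization (· ≤ ·) (⟨n, a⟩ : Germ D)
          monotone' := fun a b h => toAntisymmetrization_le_toAntisymmetrization_iff.2
            ⟨n, 𝟙 n, 𝟙 n, (D.map (𝟙 n)).hom.monotone h⟩ }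
      naturality := by
        intro n m h
        ext a
        apply le_antisymm
        · exact toAntisymmetrization_le_toAntisymmetrization_iff.2
            ⟨m, 𝟙 m, h, le_of_eq (map_map_app D h (𝟙 m) h a)⟩
        · exact toAntisymmetrization_le_toAntisymmetrization_iff.2
            ⟨m, h, 𝟙 m, ge_of_eq (map_map_app D h (𝟙 m) h a)⟩ }

lemma seqCocone_isSeqColim (D : ℕ ⥤ PartOrd.{u}) : IsSeqColim (seqCocone D) := by
  constructor
  · intro x
    induction x using Antisymmetrization.ind with
    | _ p => exact ⟨p.1, p.2, rfl⟩
  · intro n a b h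
    obtain ⟨k, hp, hq, h⟩ := toAntisymmetrization_le_toAntisymmetrization_iff.1 h
    refine ⟨k, hp, ?_⟩
    rw [Subsingleton.elim hp hq] at h ⊢
    exact h

lemma isSeqColim_of_isColimit {D : ℕ ⥤ PartOrd.{u}} {c : Cocone D} (hc : IsColimit c) :
    IsSeqColim c := by
  let s := seqCocone D
  have hs := seqCocone_isSeqColim D
  have hinv : hc.desc s ≫ hs.desc c = 𝟙 c.pt := by
    apply hc.hom_ext
    intro n
    rw [← Category.assoc, hc.fac, hs.fac, Category.comp_id]
  constructor
  · intro x
    obtain ⟨n, a, ha⟩ := hs.1 (hc.desc s x)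
    refine ⟨n, a, ?_⟩
    have h1 := ConcreteCategory.congr_hom hinv x
    have h2 := ConcreteCategory.congr_hom (hs.fac c n) a
    refine h2.symm.trans (Eq.trans ?_ h1)
    exact congrArg (hs.desc c) ha
  · intro n a b h
    apply hs.2 n a b
    have := (hc.desc s).hom.monotone h
    rw [← hc.fac s n]
    exact this

/-- `F` preserves colimits of sequences. -/
def PreservesSeq (F : PartOrd.{u} ⥤ PartOrd.{u}) : Prop :=
  ∀ ⦃D : ℕ ⥤ PartOrd.{u}⦄ (c : Cocone D), IsSeqColim c → IsSeqColim (F.mapCocone c)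

lemma preservesSeq_of_finitary (T : PartOrd.{u} ⥤ PartOrd.{u}) [PreservesFilteredColimits T] :
    PreservesSeq T := by
  intro D c hc
  have : PreservesFilteredColimitsOfSize.{0, 0} T :=
    preservesSmallestFilteredColimits_of_preservesFilteredColimits T
  obtain ⟨h⟩ := hc.isColimit
  exact isSeqColim_of_isColimit (isColimitOfPreserves T h)

lemma preservesSeq_dual : PreservesSeq PartOrd.dual.{u} := by
  intro D c hc
  refine ⟨hc.1, fun n a b h => ?_⟩
  exact hc.2 n b a h

lemma PreservesSeq.comp {F G : PartOrd.{u} ⥤ PartOrd.{u}} (hF : PreservesSeq F)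
    (hG : PreservesSeq G) : PreservesSeq (F ⋙ G) :=
  fun _ c hc => hG _ (hF c hc)

lemma preservesSeq_const (A : PartOrd.{u}) : PreservesSeq ((Functor.const _).obj A) :=
  fun _ _ _ => ⟨fun x => ⟨0, x, rfl⟩, fun n _ _ h => ⟨n, 𝟙 n, h⟩⟩

lemma PreservesSeq.sum {F G : PartOrd.{u} ⥤ PartOrd.{u}} (hF : PreservesSeq F)
    (hG : PreservesSeq G) : PreservesSeq (sumFunctor F G) := by
  intro D c hc
  constructor
  · rintro (x | x)
    · obtain ⟨n, a, ha⟩ := (hF c hc).1 x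
      exact ⟨n, Sum.inl a, congrArg Sum.inl ha⟩
    · obtain ⟨n, a, ha⟩ := (hG c hc).1 x
      exact ⟨n, Sum.inr a, congrArg Sum.inr ha⟩
  · rintro n (a | a) (b | b) h
    · obtain ⟨m, k, h'⟩ := (hF c hc).2 n a b (Sum.inl_le_inl_iff.1 h)
      exact ⟨m, k, Sum.inl_le_inl_iff.2 h'⟩
    · exact (Sum.not_inl_le_inr h).elim
    · exact (Sum.not_inr_le_inl h).elim
    · obtain ⟨m, k, h'⟩ := (hG c hc).2 n a b (Sum.inr_le_inr_iff.1 h)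
      exact ⟨m, k, Sum.inr_le_inr_iff.2 h'⟩

lemma IsSeqColim.lift_finite {D : ℕ ⥤ PartOrd.{u}} {c : Cocone D} (hc : IsSeqColim c)
    {A : Set c.pt} (hA : A.Finite) :
    ∃ (n : ℕ) (B : Set (D.obj n)), B.Finite ∧ c.ι.app n '' B = A := by
  induction A, hA using Set.Finite.induction_on with
  | empty => exact ⟨0, ∅, Set.finite_empty, Set.image_empty _⟩
  | @insert x A _ _ ih =>
    obtain ⟨n, B, hB, rfl⟩ := ih
    obtain ⟨m, a, rfl⟩ := hc.1 x
    refine ⟨max n m, insert (D.map (homOfLE (le_max_right n m)) a)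
      (D.map (homOfLE (le_max_left n m)) '' B), (hB.image _).insert _, ?_⟩
    rw [Set.image_insert_eq, cocone_app, Set.image_image]
    simp only [cocone_app]

lemma exists_common_bound {X : Type u} {A : Set X} (hA : A.Finite) (P : X → ℕ → Prop)
    (hmono : ∀ a m k, m ≤ k → P a m → P a k) (n : ℕ) (h : ∀ a ∈ A, ∃ m, P a m) :
    ∃ m, n ≤ m ∧ ∀ a ∈ A, P a m := by
  induction A, hA using Set.Finite.induction_on with
  | empty => exact ⟨n, le_rfl, by simp⟩
  | @insert x A _ _ ih =>
    obtain ⟨m, hm, h1⟩ := ih fun a ha => h a (Set.mem_insert_of_mem _ ha)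
    obtain ⟨k, hk⟩ := h x (Set.mem_insert _ _)
    refine ⟨max m k, hm.trans (le_max_left _ _), ?_⟩
    rintro a (rfl | ha)
    · exact hmono _ _ _ (le_max_right _ _) hk
    · exact hmono _ _ _ (le_max_left _ _) (h1 a ha)

lemma preservesSeq_lower : PreservesSeq lowerFunctor.{u} := by
  intro D c hc
  constructor
  · rintro ⟨_, A, hA, rfl⟩
    obtain ⟨n, B, hB, rfl⟩ := hc.lift_finite hA
    exact ⟨n, ⟨lowerClosure B, B, hB, rfl⟩,
      Subtype.ext (lowerClosure_image_lowerClosure (c.ι.app n).hom B)⟩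
  · rintro n ⟨_, A, hA, rfl⟩ ⟨t, ht⟩ h
    have key : ∀ a ∈ A, ∃ m, ∃ k : n ⟶ m, ∃ b ∈ t, D.map k a ≤ D.map k b := by
      intro a ha
      have h' : c.ι.app n a ∈ lowerClosure (c.ι.app n '' (t : Set (D.obj n))) :=
        h (subset_lowerClosure ⟨a, subset_lowerClosure ha, rfl⟩)
      obtain ⟨_, ⟨b, hb, rfl⟩, hab⟩ := h'
      obtain ⟨m, k, hk⟩ := hc.2 n a b hab
      exact ⟨m, k, b, hb, hk⟩
    obtain ⟨m, hnm, hm⟩ := exists_common_bound hA _ (by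
      rintro a m k hmk ⟨i, b, hb, hle⟩
      refine ⟨i ≫ homOfLE hmk, b, hb, ?_⟩
      rw [← map_map_app D i (homOfLE hmk), ← map_map_app D i (homOfLE hmk)]
      exact (D.map (homOfLE hmk)).hom.monotone hle) n key
    refine ⟨m, homOfLE hnm, ?_⟩
    change lowerClosure ((D.map (homOfLE hnm)).hom '' (lowerClosure A : Set _)) ≤
      lowerClosure ((D.map (homOfLE hnm)).hom '' (t : Set _))
    rw [lowerClosure_image_lowerClosure, lowerClosure_le]
    rintro _ ⟨a, ha, rfl⟩
    obtain ⟨k, b, hb, hle⟩ := hm a ha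
    exact ⟨_, ⟨b, hb, rfl⟩, hle⟩

lemma preservesSeq_upper : PreservesSeq upperFunctor.{u} := by
  intro D c hc
  constructor
  · rintro ⟨_, A, hA, rfl⟩
    obtain ⟨n, B, hB, rfl⟩ := hc.lift_finite hA
    exact ⟨n, ⟨upperClosure B, B, hB, rfl⟩,
      Subtype.ext (upperClosure_image_upperClosure (c.ι.app n).hom B)⟩
  · rintro n ⟨t, ht⟩ ⟨_, A, hA, rfl⟩ h
    have key : ∀ a ∈ A, ∃ m, ∃ k : n ⟶ m, ∃ b ∈ t, D.map k b ≤ D.map k a := by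
      intro a ha
      have h' : c.ι.app n a ∈ upperClosure (c.ι.app n '' (t : Set (D.obj n))) :=
        h (subset_upperClosure ⟨a, subset_upperClosure ha, rfl⟩)
      obtain ⟨_, ⟨b, hb, rfl⟩, hab⟩ := h'
      obtain ⟨m, k, hk⟩ := hc.2 n b a hab
      exact ⟨m, k, b, hb, hk⟩
    obtain ⟨m, hnm, hm⟩ := exists_common_bound hA _ (by
      rintro a m k hmk ⟨i, b, hb, hle⟩
      refine ⟨i ≫ homOfLE hmk, b, hb, ?_⟩
      rw [← map_map_app D i (homOfLE hmk), ← map_map_app D i (homOfLE hmk)]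
      exact (D.map (homOfLE hmk)).hom.monotone hle) n key
    refine ⟨m, homOfLE hnm, ?_⟩
    change upperClosure ((D.map (homOfLE hnm)).hom '' (t : Set _)) ≤
      upperClosure ((D.map (homOfLE hnm)).hom '' (upperClosure A : Set _))
    rw [upperClosure_image_upperClosure, le_upperClosure]
    rintro _ ⟨a, ha, rfl⟩
    obtain ⟨k, b, hb, hle⟩ := hm a ha
    exact ⟨_, ⟨b, hb, rfl⟩, hle⟩

section InitialAlgebra

variable (F : PartOrd.{u} ⥤ PartOrd.{u})

/-- The unique map out of the empty poset. -/
def fromEmpty (X : PartOrd.{u}) : PartOrd.of PEmpty.{u + 1} ⟶ X :=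
  PartOrd.ofHom ⟨PEmpty.elim, fun x => x.elim⟩

/-- The poset of terms of depth less than `n`. -/
def stage : ℕ → PartOrd.{u}
  | 0 => PartOrd.of PEmpty.{u + 1}
  | n + 1 => F.obj (stage n)

/-- The connecting maps of the initial chain. -/
def stageMap : (n : ℕ) → (stage F n ⟶ stage F (n + 1))
  | 0 => fromEmpty _
  | n + 1 => F.map (stageMap n)

/-- The interpretation of terms of depth less than `n` in an algebra. -/
def stageTo (A : Endofunctor.Algebra F) : (n : ℕ) → (stage F n ⟶ A.a)
  | 0 => fromEmpty _
  | n + 1 => F.map (stageTo A n) ≫ A.str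

lemma stageMap_to (A : Endofunctor.Algebra F) (n : ℕ) :
    stageMap F n ≫ stageTo F A (n + 1) = stageTo F A n := by
  induction n with
  | zero => ext x; exact PEmpty.elim x
  | succ n ih =>
    change F.map (stageMap F n) ≫ F.map (stageTo F A (n + 1)) ≫ A.str = F.map (stageTo F A n) ≫ A.str
    rw [← Category.assoc, ← F.map_comp, ih]

/-- A cocone over a sequence of maps. -/
def mkSeqCocone {W : ℕ → PartOrd.{u}} (w : ∀ n, W n ⟶ W (n + 1)) {Z : PartOrd.{u}}
    (g : ∀ n, W n ⟶ Z) (hg : ∀ n, w n ≫ g (n + 1) = g n) : Cocone (Functor.ofSequence w) where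
  pt := Z
  ι := NatTrans.ofSequence g (fun n => by
    rw [Functor.ofSequence_map_homOfLE_succ]
    exact (hg n).trans (Category.comp_id _).symm)

lemma hasInitial_algebra (hF : PreservesSeq F) : HasInitial (Endofunctor.Algebra F) := by
  let D : ℕ ⥤ PartOrd.{u} := Functor.ofSequence (stageMap F)
  let c : Cocone D := seqCocone D
  have hc : IsSeqColim c := seqCocone_isSeqColim D
  obtain ⟨hL⟩ := hc.isColimit
  obtain ⟨hFL⟩ := (hF c hc).isColimit
  have hw : ∀ n, stageMap F n ≫ c.ι.app (n + 1) = c.ι.app n := by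
    intro n
    have := c.w (homOfLE (Nat.le_add_right n 1))
    rwa [Functor.ofSequence_map_homOfLE_succ] at this
  let s : Cocone (D ⋙ F) :=
    { pt := c.pt
      ι := NatTrans.ofSequence (F := D ⋙ F) (G := (Functor.const ℕ).obj c.pt)
        (fun n => (c.ι.app (n + 1) : F.obj (stage F n) ⟶ c.pt)) (fun n => by
          have h1 : (D ⋙ F).map (homOfLE (Nat.le_add_right n 1)) = F.map (stageMap F n) := by
            change F.map (D.map _) = _
            exact congrArg F.map (Functor.ofSequence_map_homOfLE_succ (stageMap F) n)
          rw [h1]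
          exact (hw (n + 1)).trans (Category.comp_id _).symm) }
  let L : Endofunctor.Algebra F := ⟨c.pt, hFL.desc s⟩
  have hstr : ∀ n, F.map (c.ι.app n) ≫ L.str = c.ι.app (n + 1) := fun n => hFL.fac s n
  let t : ∀ A : Endofunctor.Algebra F, Cocone D := fun A =>
    mkSeqCocone (stageMap F) (stageTo F A) (stageMap_to F A)
  let d : ∀ A : Endofunctor.Algebra F, L.a ⟶ A.a := fun A => hL.desc (t A)
  have hd : ∀ A n, c.ι.app n ≫ d A = stageTo F A n := fun A n => hL.fac (t A) n
  let φ : ∀ A : Endofunctor.Algebra F, L ⟶ A := fun A =>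
    { f := d A
      h := by
        apply hFL.hom_ext
        intro n
        change F.map (c.ι.app n) ≫ F.map (d A) ≫ A.str = F.map (c.ι.app n) ≫ L.str ≫ d A
        rw [← Category.assoc, ← F.map_comp, hd, ← Category.assoc, hstr]
        exact (hd A (n + 1)).symm }
  have huniq : ∀ (A : Endofunctor.Algebra F) (f : L ⟶ A), f = φ A := by
    intro A f
    apply Endofunctor.Algebra.ext
    apply hL.hom_ext
    intro n
    refine Eq.trans ?_ (hd A n).symm
    induction n with
    | zero => ext x; exact PEmpty.elim (x : PEmpty.{u + 1})
    | succ n ih =>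
      change c.ι.app (n + 1) ≫ f.f = F.map (stageTo F A n) ≫ A.str
      have h1 : c.ι.app (n + 1) ≫ f.f = F.map (c.ι.app n) ≫ L.str ≫ f.f :=
        (congrArg (fun g => g ≫ f.f) (hstr n)).symm
      have h2 : F.map (c.ι.app n) ≫ F.map f.f = F.map (stageTo F A n) :=
        (F.map_comp _ _).symm.trans (congrArg (fun g => F.map g) ih)
      refine h1.trans ?_
      rw [← f.h, ← Category.assoc, h2]
      rfl
  exact (IsInitial.ofUniqueHom φ fun A f => huniq A f).hasInitial

end InitialAlgebra

instance hasInitial_langAlgebra (T : PartOrd.{u} ⥤ PartOrd.{u}) [PreservesFilteredColimits T]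
    (At : PartOrd.{u}) : HasInitial (Endofunctor.Algebra (langFunctor T At)) :=
  hasInitial_algebra _ <| PreservesSeq.sum
    (.sum (.sum preservesSeq_upper preservesSeq_lower)
      (preservesSeq_dual.comp ((preservesSeq_of_finitary T).comp preservesSeq_dual)))
    (preservesSeq_const At)

/-! ### The language -/

section Language

variable (T : PartOrd.{u} ⥤ PartOrd.{u}) [PreservesFilteredColimits T] (At : PartOrd.{u})

/-- The language: the algebra for `𝕌_ω + 𝕃_ω + T^∂` free on `At`. -/
noncomputable def Lang : Endofunctor.Algebra (langFunctor T At) :=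
  ⊥_ (Endofunctor.Algebra (langFunctor T At))

/-- The poset of formulas. -/
noncomputable abbrev Formula : PartOrd.{u} := (Lang T At).a

variable {T At}

/-- An atom, as a formula. -/
noncomputable def Formula.atom (p : At) : Formula T At :=
  (Lang T At).str (Sum.inr p)

/-- The conjunction of a finitely generated upperset of formulas. -/
noncomputable def Formula.conj (φ : FinUpper (Formula T At)) : Formula T At :=
  (Lang T At).str (Sum.inl (Sum.inl (Sum.inl φ)))

/-- The disjunction of a finitely generated lowerset of formulas. -/
noncomputable def Formula.disj (ψ : FinLower (Formula T At)) : Formula T At :=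
  (Lang T At).str (Sum.inl (Sum.inl (Sum.inr ψ)))

/-- The cover modality `∇`, of arity `T^∂`. -/
noncomputable def Formula.nabla (α : (dualFunctor T).obj (Formula T At)) : Formula T At :=
  (Lang T At).str (Sum.inl (Sum.inr α))

end Language

/-! ### Monotone relations and their lifting -/

/-- `R` is a monotone relation from `X` to `Y`, i.e. a monotone map `Yᵒᵖ × X → 𝟚`;
`R y x` means that `R` relates `x` to `y`. -/
def IsMonotoneRel {X Y : PartOrd.{u}} (R : Y → X → Prop) : Prop :=
  ∀ ⦃y y' : Y⦄ ⦃x x' : X⦄, R y x → y' ≤ y → x ≤ x' → R y' x'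

/-- The pairs in a relation, as a subposet of the product. -/
def relPoset {X Y : PartOrd.{u}} (R : Y → X → Prop) : PartOrd.{u} :=
  PartOrd.of {p : Y × X // R p.1 p.2}

/-- The projection to the target. -/
def relPoset.proj₀ {X Y : PartOrd.{u}} (R : Y → X → Prop) : relPoset R ⟶ Y :=
  PartOrd.ofHom ⟨fun p : {p : Y × X // R p.1 p.2} => p.1.1, fun _ _ h => h.1⟩

/-- The projection to the source. -/
def relPoset.proj₁ {X Y : PartOrd.{u}} (R : Y → X → Prop) : relPoset R ⟶ X :=
  PartOrd.ofHom ⟨fun p : {p : Y × X // R p.1 p.2} => p.1.2, fun _ _ h => h.2⟩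

/-- The relation lifting `T̄ R`. -/
def relLift (T : PartOrd.{u} ⥤ PartOrd.{u}) {X Y : PartOrd.{u}} (R : Y → X → Prop)
    (β : T.obj Y) (α : T.obj X) : Prop :=
  ∃ w : T.obj (relPoset R), β ≤ T.map (relPoset.proj₀ R) w ∧ T.map (relPoset.proj₁ R) w ≤ α

/-! ### Models and semantics -/

/-- A model: a coalgebra `c : X ⟶ T X` with a valuation, i.e. a monotone relation from `At` to
`Xᵒᵖ`, given as a monotone map from `At` to the monotone predicates on `X`. -/
structure Model (T : PartOrd.{u} ⥤ PartOrd.{u}) (At : PartOrd.{u}) extends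
    Endofunctor.Coalgebra T where
  /-- the valuation: `val p x` means that `p` holds at `x` -/
  val : At →o V →o Prop

/-- A model with a distinguished state. -/
structure PointedModel (T : PartOrd.{u} ⥤ PartOrd.{u}) (At : PartOrd.{u}) extends
    Model T At where
  /-- the distinguished state -/
  point : V

variable {T : PartOrd.{u} ⥤ PartOrd.{u}} {At : PartOrd.{u}}

/-- The element of `T^∂ (Xᵒᵖ) = (T X)ᵒᵖ` given by an element of `T X`
(along the identification of `Xᵒᵖᵒᵖ` with `X`). -/
def toDualObj {X : PartOrd.{u}} (t : T.obj X) : (dualFunctor T).obj (PartOrd.dual.obj X) :=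
  toDual (T.map (PartOrd.ofHom (OrderIso.dualDual X : X →o Xᵒᵈᵒᵈ)) t)

lemma toDualObj_anti {X : PartOrd.{u}} {s t : T.obj X} (h : s ≤ t) :
    (toDualObj t : (dualFunctor T).obj (PartOrd.dual.obj X)) ≤ toDualObj s :=
  (T.map (PartOrd.ofHom (OrderIso.dualDual X : X →o Xᵒᵈᵒᵈ))).hom.monotone h

/-- The poset of monotone predicates (uppersets) of a model, ordered by inclusion. -/
abbrev Model.Pred (M : Model T At) : PartOrd.{u} := PartOrd.of (M.V →o Prop)

/-- The predicate "all members of `φ` hold". -/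
def Model.predConj (M : Model T At) : FinUpper M.Pred →o M.Pred where
  toFun φ := ⟨fun x => ∀ P ∈ φ.1, P x, fun _ _ h hx P hP => P.monotone h (hx P hP)⟩
  monotone' _ _ h _ hx P hP := hx P (h hP)

/-- The predicate "some member of `ψ` holds". -/
def Model.predDisj (M : Model T At) : FinLower M.Pred →o M.Pred where
  toFun ψ := ⟨fun x => ∃ P ∈ ψ.1, P x, fun _ _ h ⟨P, hP, hx⟩ => ⟨P, hP, P.monotone h hx⟩⟩
  monotone' _ _ h _ := fun ⟨P, hP, hx⟩ => ⟨P, h hP, hx⟩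

/-- The predicate "`c x` is related to `α` by the `T^∂`-lifting of satisfaction". -/
def Model.predNabla (M : Model T At) : (dualFunctor T).obj M.Pred →o M.Pred where
  toFun α :=
    { toFun := fun x =>
        relLift (dualFunctor T) (X := M.Pred) (Y := PartOrd.dual.obj M.V)
          (fun x P => P (ofDual x)) (toDualObj (M.str x)) α
      monotone' := fun _ _ h ⟨w, h₀, h₁⟩ =>
        ⟨w, (toDualObj_anti (M.str.hom.monotone h)).trans h₀, h₁⟩ }
  monotone' _ _ h _ := fun ⟨w, h₀, h₁⟩ => ⟨w, h₀, h₁.trans h⟩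

/-- The algebra of monotone predicates of a model. -/
def Model.predAlgebra (M : Model T At) : Endofunctor.Algebra (langFunctor T At) where
  a := M.Pred
  str := PartOrd.ofHom
    ⟨_, monotone_sumElim
      (⟨_, monotone_sumElim (⟨_, monotone_sumElim M.predConj M.predDisj⟩) M.predNabla⟩) M.val⟩

lemma preservesExactSquares_dualFunctor (hT : PreservesExactSquares T) :
    PreservesExactSquares (dualFunctor T) := by
  intro P A B C p₀ p₁ f g h
  have := hT (PartOrd.dual.map p₁) (PartOrd.dual.map p₀) (PartOrd.dual.map g) (PartOrd.dual.map f)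
    ⟨h.1, fun b a hab => (h.2 a b hab).imp fun _ hw => hw.symm⟩
  exact ⟨this.1, fun a b hab => (this.2 b a hab).imp fun _ hw => hw.symm⟩

section Semantics

variable [PreservesFilteredColimits T]

/-- The interpretation of formulas as monotone predicates: the unique algebra morphism out of the
free algebra that extends the valuation. -/
noncomputable def Model.sem (M : Model T At) : Formula T At ⟶ M.Pred :=
  (initial.to M.predAlgebra).f

/-- Satisfaction `x ⊩ a`: the unique extension of the valuation to all formulas that interprets
the connectives by the operations on predicates. The recursive clauses are `sat_atom`, `sat_conj`,
`sat_disj` and `sat_nabla` below. -/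
noncomputable def Model.Sat (M : Model T At) (x : M.V) (a : Formula T At) : Prop :=
  (M.sem a : M.V →o Prop) x

lemma Model.sat_mono (M : Model T At) {x x' : M.V} {a a' : Formula T At} (hx : x ≤ x')
    (ha : a ≤ a') (h : M.Sat x a) : M.Sat x' a' :=
  M.sem.hom.monotone ha x' (OrderHom.monotone (M.sem a : M.V →o Prop) hx h)

lemma Model.sem_str (M : Model T At) (z : (langFunctor T At).obj (Formula T At)) :
    M.sem ((Lang T At).str z) =
      M.predAlgebra.str ((langFunctor T At).map M.sem z) :=
  (ConcreteCategory.congr_hom (initial.to M.predAlgebra).h z).symm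

lemma Model.sat_str (M : Model T At) (x : M.V) (z : (langFunctor T At).obj (Formula T At)) :
    M.Sat x ((Lang T At).str z) ↔
      (show M.V →o Prop from M.predAlgebra.str ((langFunctor T At).map M.sem z)) x :=
  iff_of_eq (congrArg (fun P : M.V →o Prop => P x) (M.sem_str z))

theorem Model.sat_atom (M : Model T At) (x : M.V) (p : At) :
    M.Sat x (Formula.atom p) ↔ M.val p x :=
  M.sat_str x (Sum.inr p)

theorem Model.sat_conj (M : Model T At) (x : M.V) (φ : FinUpper (Formula T At)) :
    M.Sat x (Formula.conj φ) ↔ ∀ a ∈ φ.1, M.Sat x a := by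
  have h : M.Sat x (Formula.conj φ) ↔
      ∀ P ∈ upperClosure (M.sem '' (φ.1 : Set (Formula T At))),
        (P : M.V →o Prop) x :=
    M.sat_str x (Sum.inl (Sum.inl (Sum.inl φ)))
  rw [h]
  constructor
  · exact fun h a ha => h _ (subset_upperClosure ⟨a, ha, rfl⟩)
  · rintro h P ⟨_, ⟨a, ha, rfl⟩, hle⟩
    exact hle x (h a ha)

theorem Model.sat_disj (M : Model T At) (x : M.V) (ψ : FinLower (Formula T At)) :
    M.Sat x (Formula.disj ψ) ↔ ∃ a ∈ ψ.1, M.Sat x a := by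
  have h : M.Sat x (Formula.disj ψ) ↔
      ∃ P ∈ lowerClosure (M.sem '' (ψ.1 : Set (Formula T At))),
        (P : M.V →o Prop) x :=
    M.sat_str x (Sum.inl (Sum.inl (Sum.inr ψ)))
  rw [h]
  constructor
  · rintro ⟨P, ⟨_, ⟨a, ha, rfl⟩, hle⟩, hx⟩
    exact ⟨a, ha, hle x hx⟩
  · exact fun ⟨a, ha, hx⟩ => ⟨_, subset_lowerClosure ⟨a, ha, rfl⟩, hx⟩

theorem Model.sat_nabla (hT : PreservesExactSquares T) (M : Model T At) (x : M.V)
    (α : (dualFunctor T).obj (Formula T At)) :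
    M.Sat x (Formula.nabla α) ↔
      relLift (dualFunctor T) (X := Formula T At) (Y := PartOrd.dual.obj M.V)
        (fun x a => M.Sat (ofDual x) a) (toDualObj (M.str x)) α := by
  let s : Formula T At ⟶ M.Pred := M.sem
  let R : PartOrd.dual.obj M.V → M.Pred → Prop := fun x P => P (ofDual x)
  let Q : PartOrd.dual.obj M.V → Formula T At → Prop := fun x a => M.Sat (ofDual x) a
  have h : M.Sat x (Formula.nabla α) ↔
      relLift (dualFunctor T) R (toDualObj (M.str x)) ((dualFunctor T).map s α) :=
    M.sat_str x (Sum.inl (Sum.inr α))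
  rw [h]
  constructor
  · rintro ⟨w, h₀, h₁⟩
    let K : PartOrd.{u} := PartOrd.of
      {q : relPoset R × Formula T At // relPoset.proj₁ R q.1 ≤ s q.2}
    let k₀ : K ⟶ relPoset R := PartOrd.ofHom
      ⟨fun q : {q : relPoset R × Formula T At // relPoset.proj₁ R q.1 ≤ s q.2} => q.1.1,
        fun _ _ h => h.1⟩
    let k₁ : K ⟶ Formula T At := PartOrd.ofHom
      ⟨fun q : {q : relPoset R × Formula T At // relPoset.proj₁ R q.1 ≤ s q.2} => q.1.2,
        fun _ _ h => h.2⟩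
    have hex : IsExactSquare k₀ k₁ (relPoset.proj₁ R) s :=
      ⟨fun q => q.2, fun e a hea => ⟨⟨(e, a), hea⟩, le_rfl, le_rfl⟩⟩
    obtain ⟨v, hv₀, hv₁⟩ := (preservesExactSquares_dualFunctor hT _ _ _ _ hex).2 w α h₁
    let r : K ⟶ relPoset Q := PartOrd.ofHom
      ⟨fun q : {q : relPoset R × Formula T At // relPoset.proj₁ R q.1 ≤ s q.2} =>
        (⟨(relPoset.proj₀ R q.1.1, q.1.2), q.2 _ q.1.1.2⟩ :
          {p : PartOrd.dual.obj M.V × Formula T At // Q p.1 p.2}),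
        fun _ _ h => ⟨(relPoset.proj₀ R).hom.monotone h.1, h.2⟩⟩
    refine ⟨(dualFunctor T).map r v, ?_, ?_⟩
    · have e : r ≫ relPoset.proj₀ Q = k₀ ≫ relPoset.proj₀ R := rfl
      have e' := ConcreteCategory.congr_hom (congrArg (dualFunctor T).map e) v
      rw [Functor.map_comp, Functor.map_comp] at e'
      refine h₀.trans (le_trans ?_ (le_of_eq e'.symm))
      exact ((dualFunctor T).map (relPoset.proj₀ R)).hom.monotone hv₀
    · have e : r ≫ relPoset.proj₁ Q = k₁ := rfl
      have e' := ConcreteCategory.congr_hom (congrArg (dualFunctor T).map e) v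
      rw [Functor.map_comp] at e'
      exact (le_of_eq e').trans hv₁
  · rintro ⟨w, h₀, h₁⟩
    let r : relPoset Q ⟶ relPoset R := PartOrd.ofHom
      ⟨fun q : {p : PartOrd.dual.obj M.V × Formula T At // Q p.1 p.2} =>
        (⟨(q.1.1, s q.1.2), q.2⟩ : {p : PartOrd.dual.obj M.V × M.Pred // R p.1 p.2}),
        fun _ _ h => ⟨h.1, s.hom.monotone h.2⟩⟩
    refine ⟨(dualFunctor T).map r w, ?_, ?_⟩
    · have e : r ≫ relPoset.proj₀ R = relPoset.proj₀ Q := rfl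
      have e' := ConcreteCategory.congr_hom (congrArg (dualFunctor T).map e) w
      rw [Functor.map_comp] at e'
      exact h₀.trans (le_of_eq e'.symm)
    · have e : r ≫ relPoset.proj₁ R = relPoset.proj₁ Q ≫ s := rfl
      have e' := ConcreteCategory.congr_hom (congrArg (dualFunctor T).map e) w
      rw [Functor.map_comp, Functor.map_comp] at e'
      exact (le_of_eq e').trans (((dualFunctor T).map s).hom.monotone h₁)

end Semantics

/-! ### Simulations and modal strength -/

/-- `S` is a `T`-simulation from the pointed model `N` to the pointed model `M`: a monotone
relation from the states of `N` to the states of `M` such that (a), (b) and (c) hold. -/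
structure IsSimulation (N M : PointedModel T At) (S : M.V → N.V → Prop) : Prop where
  /-- `S` is a monotone relation -/
  monotone : IsMonotoneRel (X := N.V) (Y := M.V) S
  /-- (a) the distinguished states are related -/
  point : S M.point N.point
  /-- (b) related states have successors related by the lifting of `S` -/
  lift : ∀ (x : M.V) (y : N.V), S x y → relLift T S (M.str x) (N.str y)
  /-- (c) atoms are transferred -/
  atoms : ∀ (x : M.V) (y : N.V), S x y → ∀ p : At, M.val p x → N.val p y

/-- `N` simulates `M`. -/
def Simulates (N M : PointedModel T At) : Prop :=
  ∃ S : M.V → N.V → Prop, IsSimulation N M S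

/-- The state `y` of `N` is modally stronger than the state `x` of `M`. -/
def ModallyStrongerAt [PreservesFilteredColimits T] (N M : Model T At) (x : M.V) (y : N.V) :
    Prop :=
  ∀ a : Formula T At, M.Sat x a → N.Sat y a

/-- `N` is modally stronger than `M`. -/
def ModallyStronger [PreservesFilteredColimits T] (N M : PointedModel T At) : Prop :=
  ModallyStrongerAt N.toModel M.toModel M.point N.point

end NablaLogic

/-! Both directions rest on one calculus of liftings. Since `T` preserves exact squares, lifting
respects composition of relations (`relLift.comp`) and restriction of monotone relations along maps
(`relLift.restrict`), while pushing forward along maps (`relLift.map`) needs functoriality only.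
`Model.sat_nabla_iff` brings `∇` into this calculus: satisfaction of `∇ α` at `x` is the `T`-lifting
of satisfaction, relating `α` to the successor structure of `x`.

Adequacy is an induction on formulas whose only substantial case is `∇`. There satisfaction,
restricted to the formulas that carry the induction hypothesis, is composed with the simulation.

Expressivity uses finitariness. The successors of `x` and `y` are images of elements over finite
posets `A` and `B`, so finitely many formulas distinguish the states that matter.
`exists_characteristic_formulas` assembles them into a monotone map `f` from `A` to the dual of the
formulas: `f a` holds at the state named by `a`, and a state named by `b` satisfies `f a` only if it
is modally stronger. The formula `∇ (T f s)`, with `s` the element over `A`, therefore holds at `x`,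
hence at `y`. Restricting its satisfaction at `y` to `A` and `B` and pushing forward yields the
lifting of modal strength. -/

namespace NablaLogic

/-! ### Relation lifting -/

section RelLift

variable {T : PartOrd.{u} ⥤ PartOrd.{u}}

lemma map_comp_apply (T : PartOrd.{u} ⥤ PartOrd.{u}) {X Y Z : PartOrd.{u}} (f : X ⟶ Y)
    (g : Y ⟶ Z) (t : T.obj X) : T.map (f ≫ g) t = T.map g (T.map f t) := by
  rw [T.map_comp]; rfl

lemma map_monotone (T : PartOrd.{u} ⥤ PartOrd.{u}) {X Y : PartOrd.{u}} (f : X ⟶ Y)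
    {s t : T.obj X} (h : s ≤ t) : T.map f s ≤ T.map f t :=
  (T.map f).hom.monotone h

/-- Liftings are witnessed by spans contained in the relation. -/
lemma relLift_of_span {P X Y : PartOrd.{u}} {R : Y → X → Prop} (f : P ⟶ Y) (g : P ⟶ X)
    (h : ∀ p, R (f p) (g p)) {w : T.obj P} {β : T.obj Y} {α : T.obj X}
    (h₀ : β ≤ T.map f w) (h₁ : T.map g w ≤ α) : relLift T R β α := by
  let r : P ⟶ relPoset R := PartOrd.ofHom
    ⟨fun p => (⟨(f p, g p), h p⟩ : {p : Y × X // R p.1 p.2}),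
      fun _ _ h => ⟨f.hom.monotone h, g.hom.monotone h⟩⟩
  refine ⟨T.map r w, ?_, ?_⟩
  · rw [← map_comp_apply]; exact h₀
  · rw [← map_comp_apply]; exact h₁

/-- Liftings are preserved by pairs of maps that preserve the relation. -/
lemma relLift.map {A B X Y : PartOrd.{u}} {Q : A → B → Prop} {R : Y → X → Prop} (f : A ⟶ Y)
    (g : B ⟶ X) (h : ∀ a b, Q a b → R (f a) (g b)) {β : T.obj A} {α : T.obj B}
    (hQ : relLift T Q β α) : relLift T R (T.map f β) (T.map g α) := by
  obtain ⟨w, h₀, h₁⟩ := hQ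
  refine relLift_of_span (relPoset.proj₀ Q ≫ f) (relPoset.proj₁ Q ≫ g) (fun p => h _ _ p.2)
    (w := w) ?_ ?_
  · rw [map_comp_apply]; exact map_monotone T f h₀
  · rw [map_comp_apply]; exact map_monotone T g h₁

/-- Comma squares are exact, so their lifting is the order between the images. -/
lemma relLift_comma (hT : PreservesExactSquares T) {A B C : PartOrd.{u}} (f : A ⟶ C) (g : B ⟶ C)
    {a : T.obj A} {b : T.obj B} (h : T.map f a ≤ T.map g b) :
    relLift T (fun x y => f x ≤ g y) a b :=
  (hT (relPoset.proj₀ fun x y => f x ≤ g y) (relPoset.proj₁ fun x y => f x ≤ g y) f g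
    ⟨fun w => w.2, fun x y hxy => ⟨⟨(x, y), hxy⟩, le_rfl, le_rfl⟩⟩).2 a b h

/-- Lifting is compatible with composition of relations. -/
lemma relLift.comp (hT : PreservesExactSquares T) {A B C : PartOrd.{u}} {R : A → B → Prop}
    {S : B → C → Prop} {Q : A → C → Prop}
    (h : ∀ a b b' c, R a b → b ≤ b' → S b' c → Q a c) {α : T.obj A} {β : T.obj B} {γ : T.obj C}
    (hR : relLift T R α β) (hS : relLift T S β γ) : relLift T Q α γ := by
  obtain ⟨w, h₀, h₁⟩ := hR
  obtain ⟨v, h₂, h₃⟩ := hS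
  -- The two witnesses need not agree over `B`; they are only ordered there, through `β`. Gluing
  -- them over the comma of the two projections leaves the gap `b ≤ b'` that `h` has to bridge.
  obtain ⟨z, h₄, h₅⟩ := relLift_comma hT _ _ (h₁.trans h₂)
  refine relLift_of_span (relPoset.proj₀ _ ≫ relPoset.proj₀ R) (relPoset.proj₁ _ ≫ relPoset.proj₁ S)
    (fun p => h _ _ _ _ p.1.1.2 p.2 p.1.2.2) (w := z) ?_ ?_
  · rw [map_comp_apply]; exact h₀.trans (map_monotone T _ h₄)
  · rw [map_comp_apply]; exact (map_monotone T _ h₅).trans h₃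

/-- Lifting is compatible with restriction of a relation along a pair of maps. -/
lemma relLift.restrict (hT : PreservesExactSquares T) {A B X Y : PartOrd.{u}} {R : Y → X → Prop}
    (hR : IsMonotoneRel R) (f : A ⟶ Y) (g : B ⟶ X) {a : T.obj A} {b : T.obj B}
    (h : relLift T R (T.map f a) (T.map g b)) : relLift T (fun x y => R (f x) (g y)) a b := by
  obtain ⟨w, h₀, h₁⟩ := h
  -- The restricted relation factors through the poset of pairs in `R`: below the first component,
  -- then up from the second. Each factor is a comma relation, so exactness lifts it.
  refine relLift.comp hT (R := fun x (e : relPoset R) => f x ≤ relPoset.proj₀ R e)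
    (S := fun (e : relPoset R) y => relPoset.proj₁ R e ≤ g y) ?_
    (relLift_comma hT _ _ h₀) (relLift_comma hT _ _ h₁)
  intro x e e' y hx he hy
  exact hR e.2 hx (((relPoset.proj₁ R).hom.monotone he).trans hy)

end RelLift

/-! ### Finitary functors -/

section Finitary

/-- The finite subposets of a poset. -/
def finsetDiagram (X : PartOrd.{u}) : Finset X ⥤ PartOrd.{u} where
  obj s := PartOrd.of {x : X // x ∈ s}
  map h := PartOrd.ofHom ⟨fun x => ⟨x.1, leOfHom h x.2⟩, fun _ _ h => h⟩

/-- A poset as a cocone over its finite subposets. -/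
def finsetCocone (X : PartOrd.{u}) : Cocone (finsetDiagram X) where
  pt := X
  ι := { app := fun s => PartOrd.ofHom ⟨fun x : {x : X // x ∈ s} => x.1, fun _ _ h => h⟩ }

/-- A poset is the directed colimit of its finite subposets. -/
def finsetCoconeIsColimit (X : PartOrd.{u}) : IsColimit (finsetCocone X) := by
  classical
  -- The value of a cocone at `x` does not depend on the finite set containing it. The mediating map
  -- can thus be read off singletons, and `x ≤ y` can be compared inside `{x, y}`.
  have key (c : Cocone (finsetDiagram X)) {s t : Finset X} (h : s ⊆ t) (x : X) (hx : x ∈ s) :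
      c.ι.app s (⟨x, hx⟩ : {x : X // x ∈ s}) = c.ι.app t (⟨x, h hx⟩ : {x : X // x ∈ t}) :=
    (ConcreteCategory.congr_hom (c.w (homOfLE h)) (⟨x, hx⟩ : {x : X // x ∈ s})).symm
  exact
  { desc := fun c => PartOrd.ofHom
      { toFun := fun x => c.ι.app {x}
          (⟨x, Finset.mem_singleton_self x⟩ : {y : X // y ∈ ({x} : Finset X)})
        monotone' := fun x y hxy =>
          (key c (show ({x} : Finset X) ⊆ {x, y} by simp) x _).trans_le
            (((c.ι.app {x, y}).hom.monotone hxy).trans_eq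
              (key c (show ({y} : Finset X) ⊆ {x, y} by simp) y (by simp)).symm) }
    fac := fun c s => by
      ext x
      exact key c (Finset.singleton_subset_iff.2 x.2) x.1 _
    uniq := fun c f hf => by
      ext x
      exact ConcreteCategory.congr_hom (hf {x})
        (⟨x, Finset.mem_singleton_self x⟩ : {y : X // y ∈ ({x} : Finset X)}) }

/-- The maps of a colimit cocone of posets are jointly surjective. -/
lemma jointly_surjective_of_isColimit {J : Type u} [Category.{u} J] {D : J ⥤ PartOrd.{u}}
    {c : Cocone D} (hc : IsColimit c) (x : c.pt) : ∃ (j : J) (a : D.obj j), c.ι.app j a = x := by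
  -- The cocone corestricts to its joint image `Z`. By uniqueness the identity of the colimit then
  -- factors through the inclusion of `Z`, which is therefore everything.
  let Z : PartOrd.{u} := PartOrd.of {x : c.pt // ∃ (j : J) (a : D.obj j), c.ι.app j a = x}
  let i : Z ⟶ c.pt := PartOrd.ofHom ⟨Subtype.val, fun _ _ h => h⟩
  let s : Cocone D :=
    { pt := Z
      ι :=
        { app := fun j => PartOrd.ofHom
            ⟨fun a => ⟨c.ι.app j a, j, a, rfl⟩, fun _ _ h => (c.ι.app j).hom.monotone h⟩
          naturality := fun j k h => by
            ext a
            exact Subtype.ext (ConcreteCategory.congr_hom (c.w h) a) } }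
  have h : hc.desc s ≫ i = 𝟙 c.pt := hc.hom_ext fun j => by
    rw [← Category.assoc, hc.fac, Category.comp_id]; rfl
  have hx : (hc.desc s x : {x : c.pt // ∃ (j : J) (a : D.obj j), c.ι.app j a = x}).1 = x :=
    ConcreteCategory.congr_hom h x
  exact hx ▸ (hc.desc s x : {x : c.pt // ∃ (j : J) (a : D.obj j), c.ι.app j a = x}).2

/-- Every element of `T X` comes from a finite poset. -/
lemma exists_finite_support (T : PartOrd.{u} ⥤ PartOrd.{u}) [PreservesFilteredColimits T]
    {X : PartOrd.{u}} (t : T.obj X) :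
    ∃ (A : PartOrd.{u}) (_ : Finite A) (i : A ⟶ X) (a : T.obj A), T.map i a = t := by
  classical
  obtain ⟨s, a, h⟩ :=
    jointly_surjective_of_isColimit (isColimitOfPreserves T (finsetCoconeIsColimit X)) t
  exact ⟨_, inferInstanceAs (Finite {x : X // x ∈ s}), _, a, h⟩

end Finitary

/-! ### Formulas and satisfaction -/

section Formulas

variable {T : PartOrd.{u} ⥤ PartOrd.{u}} [PreservesFilteredColimits T] {At : PartOrd.{u}}

/-- The inclusion of a subposet. -/
def subInclusion {X : PartOrd.{u}} (P : X → Prop) : PartOrd.of {x : X // P x} ⟶ X :=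
  PartOrd.ofHom ⟨Subtype.val, fun _ _ h => h⟩

/-- Structural induction on elements of an initial algebra. -/
lemma initial_induction {F : PartOrd.{u} ⥤ PartOrd.{u}} {L : Endofunctor.Algebra F}
    (hL : IsInitial L) {P : L.a → Prop}
    (h : ∀ z : F.obj (PartOrd.of {a : L.a // P a}), P (L.str (F.map (subInclusion P) z)))
    (a : L.a) : P a := by
  -- Closure under the operations makes `P` a subalgebra, and initiality splits its inclusion.
  -- Arguments range over `F` applied to the subposet because an element of `F.obj L.a` need not
  -- have elementwise subterms.
  let B : Endofunctor.Algebra F :=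
    { a := PartOrd.of {a : L.a // P a}
      str := PartOrd.ofHom ⟨fun z => ⟨L.str (F.map (subInclusion P) z), h z⟩,
        fun _ _ h => L.str.hom.monotone (map_monotone F _ h)⟩ }
  let i : B ⟶ L := { f := subInclusion P, h := rfl }
  have e : hL.to B ≫ i = 𝟙 L := hL.hom_ext _ _
  have ha : ((hL.to B).f a : {a : L.a // P a}).1 = a :=
    ConcreteCategory.congr_hom (congrArg Endofunctor.Algebra.Hom.f e) a
  exact ha ▸ ((hL.to B).f a : {a : L.a // P a}).2

/-- Structural induction on formulas. -/
lemma Formula.induction {P : Formula T At → Prop} (atom : ∀ p : At, P (Formula.atom p))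
    (conj : ∀ φ : FinUpper (PartOrd.of {a : Formula T At // P a}),
      P (Formula.conj (FinUpper.map (subInclusion P).hom φ)))
    (disj : ∀ ψ : FinLower (PartOrd.of {a : Formula T At // P a}),
      P (Formula.disj (FinLower.map (subInclusion P).hom ψ)))
    (nabla : ∀ α : (dualFunctor T).obj (PartOrd.of {a : Formula T At // P a}),
      P (Formula.nabla ((dualFunctor T).map (subInclusion P) α)))
    (a : Formula T At) : P a := by
  refine initial_induction (L := Lang T At) initialIsInitial ?_ a
  rintro (((φ | ψ) | α) | p)
  · exact conj φ
  · exact disj ψ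
  · exact nabla α
  · exact atom p

/-- The satisfaction relation, from the states to the dual of the poset of formulas. -/
def Model.satRel (M : Model T At) : PartOrd.dual.obj (Formula T At) → M.V → Prop :=
  fun a x => M.Sat x (ofDual a)

lemma Model.satRel_monotone (M : Model T At) : IsMonotoneRel M.satRel :=
  fun _ _ _ _ h ha hx => M.sat_mono hx ha h

/-- Satisfaction of `∇`, in terms of the lifting by `T` instead of `T^∂`. -/
lemma Model.sat_nabla_iff (hT : PreservesExactSquares T) (M : Model T At) (x : M.V)
    (α : (dualFunctor T).obj (Formula T At)) :
    M.Sat x (Formula.nabla α) ↔ relLift T M.satRel (ofDual α) (M.str x) := by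
  rw [M.sat_nabla hT]
  let Q : PartOrd.dual.obj M.V → Formula T At → Prop := fun x a => M.Sat (ofDual x) a
  -- `toDualObj` transports along `d`, the passage to the double dual; `e` undoes it.
  let d : M.V ⟶ PartOrd.dual.obj (PartOrd.dual.obj M.V) :=
    PartOrd.ofHom (OrderIso.dualDual M.V : M.V →o M.Vᵒᵈᵒᵈ)
  let e : PartOrd.dual.obj (PartOrd.dual.obj M.V) ⟶ M.V :=
    PartOrd.ofHom ((OrderIso.dualDual M.V).symm : M.Vᵒᵈᵒᵈ →o M.V)
  have hde : T.map e (T.map d (M.str x)) = M.str x := by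
    rw [← map_comp_apply, show d ≫ e = 𝟙 _ from rfl, T.map_id]; rfl
  constructor
  · rintro ⟨w, h₀, h₁⟩
    -- A witness for `T^∂` lives over the poset of pairs in `Q`; seen through `T` it lives over the
    -- dual of that poset. Projections and inequalities accordingly trade places.
    refine relLift_of_span (P := PartOrd.dual.obj (relPoset Q))
      (PartOrd.dual.map (relPoset.proj₁ Q)) (PartOrd.dual.map (relPoset.proj₀ Q) ≫ e)
      (fun p => (ofDual p).2) (w := ofDual w) h₁ ?_
    rw [map_comp_apply, ← hde]
    exact map_monotone T e h₀
  · rintro ⟨w, h₀, h₁⟩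
    let r : relPoset M.satRel ⟶ PartOrd.dual.obj (relPoset Q) := PartOrd.ofHom
      ⟨fun p => toDual ⟨(toDual p.1.2, ofDual p.1.1), p.2⟩, fun _ _ h => ⟨h.2, h.1⟩⟩
    refine ⟨toDual (T.map r w), ?_, ?_⟩
    · change T.map (PartOrd.dual.map (relPoset.proj₀ Q)) (T.map r w) ≤ T.map d (M.str x)
      rw [← map_comp_apply]
      have := map_monotone T d h₁
      rw [← map_comp_apply] at this
      exact this
    · have h := map_comp_apply T r (PartOrd.dual.map (relPoset.proj₁ Q)) w
      exact h₀.trans_eq h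

/-- Satisfaction is monotone in the formula, so testing generators is enough. -/
lemma Model.sat_conj_upperClosure (M : Model T At) (x : M.V) {A : Set (Formula T At)}
    (hA : A.Finite) :
    M.Sat x (Formula.conj ⟨upperClosure A, A, hA, rfl⟩) ↔ ∀ a ∈ A, M.Sat x a := by
  rw [M.sat_conj]
  refine ⟨fun h a ha => h a (subset_upperClosure ha), ?_⟩
  rintro h b ⟨a, ha, hab⟩
  exact M.sat_mono le_rfl hab (h a ha)

lemma Model.sat_disj_lowerClosure (M : Model T At) (x : M.V) {A : Set (Formula T At)}
    (hA : A.Finite) :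
    M.Sat x (Formula.disj ⟨lowerClosure A, A, hA, rfl⟩) ↔ ∃ a ∈ A, M.Sat x a := by
  rw [M.sat_disj]
  refine ⟨?_, fun ⟨a, ha, h⟩ => ⟨a, subset_lowerClosure ha, h⟩⟩
  rintro ⟨b, ⟨a, ha, hba⟩, h⟩
  exact ⟨a, ha, M.sat_mono le_rfl hba h⟩

end Formulas

/-! ### Adequacy and expressivity -/

section HennessyMilner

variable {T : PartOrd.{u} ⥤ PartOrd.{u}} [PreservesFilteredColimits T] {At : PartOrd.{u}}

/-- Simulations preserve satisfaction of formulas. -/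
lemma IsSimulation.sat (hT : PreservesExactSquares T) {M N : PointedModel T At}
    {S : M.V → N.V → Prop} (hS : IsSimulation N M S) (a : Formula T At) :
    ∀ (x : M.V) (y : N.V), S x y → M.Sat x a → N.Sat y a := by
  induction a using Formula.induction (T := T) (At := At) with
  | atom p =>
    intro x y hxy h
    rw [Model.sat_atom] at h ⊢
    exact hS.atoms x y hxy p h
  | conj φ =>
    intro x y hxy h
    rw [Model.sat_conj] at h ⊢
    -- `b` need not carry the induction hypothesis itself, but it lies above some `a` that does.
    rintro b ⟨_, ⟨a, ha, rfl⟩, hab⟩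
    exact N.sat_mono le_rfl hab (a.2 x y hxy (h _ (subset_upperClosure ⟨a, ha, rfl⟩)))
  | disj ψ =>
    intro x y hxy h
    rw [Model.sat_disj] at h ⊢
    -- Dually, `b` lies below some `a` with the induction hypothesis, and `a` also holds at `x`.
    obtain ⟨b, ⟨_, ⟨a, ha, rfl⟩, hba⟩, h⟩ := h
    exact ⟨_, subset_lowerClosure ⟨a, ha, rfl⟩, a.2 x y hxy (M.sat_mono le_rfl hba h)⟩
  | nabla α =>
    intro x y hxy h
    rw [Model.sat_nabla_iff hT] at h ⊢
    let P : Formula T At → Prop := fun a =>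
      ∀ (x : M.V) (y : N.V), S x y → M.Sat x a → N.Sat y a
    let i := PartOrd.dual.map (subInclusion P)
    have h' : relLift T M.satRel (T.map i (ofDual α)) (T.map (𝟙 M.V) (M.str x)) := by
      rw [T.map_id]; exact h
    -- The restriction must precede the composition with `S`: only for formulas in `P` is the
    -- composite known to be contained in satisfaction in `N`.
    have h₁ := relLift.restrict hT M.satRel_monotone i (𝟙 M.V) h'
    have h₂ : relLift T (fun a y => N.satRel (i a) y) (ofDual α) (N.str y) := by
      refine relLift.comp hT ?_ h₁ (hS.lift x y hxy)
      intro a x x' y ha hx hy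
      exact (ofDual a).2 x' y hy (M.sat_mono hx le_rfl ha)
    have h₃ := relLift.map (R := N.satRel) i (𝟙 N.V) (fun _ _ h => h) h₂
    rw [T.map_id] at h₃
    exact h₃

/-- Finitely many states of `M` have formulas, antitone in the state, that hold there and fail at
all of finitely many states of `N` that are not modally stronger. -/
lemma exists_characteristic_formulas (M N : Model T At) {A B : PartOrd.{u}} [Finite A] [Finite B]
    (i : A ⟶ M.V) (j : B ⟶ N.V) :
    ∃ f : A ⟶ PartOrd.dual.obj (Formula T At), (∀ a, M.satRel (f a) (i a)) ∧
      ∀ a b, N.satRel (f a) (j b) → ModallyStrongerAt N M (i a) (j b) := by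
  have hsep : ∀ (a : A) (b : B), ∃ φ : Formula T At, M.Sat (i a) φ ∧
      (N.Sat (j b) φ → ModallyStrongerAt N M (i a) (j b)) ∨ ModallyStrongerAt N M (i a) (j b) := by
    intro a b
    by_cases h : ModallyStrongerAt N M (i a) (j b)
    -- No separating formula exists here. The empty conjunction is a dummy value, which `C` leaves
    -- out.
    · exact ⟨Formula.conj ⟨upperClosure ∅, ∅, Set.finite_empty, rfl⟩, Or.inr h⟩
    · simp only [ModallyStrongerAt, not_forall] at h
      obtain ⟨φ, h₁, h₂⟩ := h
      exact ⟨φ, Or.inl ⟨h₁, fun h => (h₂ h).elim⟩⟩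
  choose φ hφ using hsep
  let C (a : A) : Set (Formula T At) :=
    φ a '' {b | ¬ ModallyStrongerAt N M (i a) (j b)}
  have hC (a : A) : (C a).Finite := (Set.toFinite _).image _
  -- `χ a` holds at `i a` and fails at each `j b` that is not modally stronger. The conjunction is
  -- finite because `B` is.
  let χ (a : A) : Formula T At := Formula.conj ⟨upperClosure (C a), C a, hC a, rfl⟩
  have hD (a : A) : (χ '' Set.Ici a).Finite := (Set.toFinite _).image _
  -- The separating formulas are arbitrary choices, so `χ` need not be antitone. Taking the
  -- disjunction over all `a' ≥ a`, finite because `A` is, forces this. Nothing is lost: whatever is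
  -- modally stronger than `i a'` is also modally stronger than `i a`.
  refine ⟨PartOrd.ofHom
    ⟨fun a => toDual (Formula.disj ⟨lowerClosure (χ '' Set.Ici a), _, hD a, rfl⟩), ?_⟩, ?_, ?_⟩
  · intro a a' h
    refine (Lang T At).str.hom.monotone
      (Sum.inl_le_inl_iff.2 (Sum.inl_le_inl_iff.2 (Sum.inr_le_inr_iff.2 ?_)))
    exact lowerClosure_mono (Set.image_mono (Set.Ici_subset_Ici.2 h))
  · intro a
    refine (M.sat_disj_lowerClosure (i a) (hD a)).2 ⟨_, ⟨a, le_rfl, rfl⟩, ?_⟩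
    refine (M.sat_conj_upperClosure (i a) (hC a)).2 ?_
    rintro _ ⟨b, hb, rfl⟩
    exact ((hφ a b).resolve_right hb).1
  · intro a b h
    obtain ⟨_, ⟨a', ha, rfl⟩, h⟩ := (N.sat_disj_lowerClosure (j b) (hD a)).1 h
    have h' := (N.sat_conj_upperClosure (j b) (hC a')).1 h
    have hs : ModallyStrongerAt N M (i a') (j b) := by
      by_contra hb
      exact hb (((hφ a' b).resolve_right hb).2 (h' _ ⟨b, hb, rfl⟩))
    exact fun ψ hψ => hs ψ (M.sat_mono (i.hom.monotone ha) le_rfl hψ)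

/-- States related by modal strength have successors related by its lifting. -/
lemma ModallyStrongerAt.relLift (hT : PreservesExactSquares T) {M N : Model T At} {x : M.V}
    {y : N.V} (h : ModallyStrongerAt N M x y) :
    relLift T (ModallyStrongerAt N M) (M.str x) (N.str y) := by
  obtain ⟨A, _, i, s, hs⟩ := exists_finite_support T (M.str x)
  obtain ⟨B, _, j, t, ht⟩ := exists_finite_support T (N.str y)
  obtain ⟨f, hf, hf'⟩ := exists_characteristic_formulas M N i j
  -- The span `(f, i)` out of `A` lies inside satisfaction, so `s` itself witnesses the lifting.
  have hx : M.Sat x (Formula.nabla (toDual (T.map f s))) :=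
    (M.sat_nabla_iff hT x _).2 (relLift_of_span f i hf le_rfl hs.le)
  have hy := (N.sat_nabla_iff hT y _).1 (h _ hx)
  rw [← ht] at hy
  rw [← hs, ← ht]
  -- Over `A` and `B`, satisfaction of characteristic formulas is contained in modal strength, by
  -- `hf'`.
  exact (relLift.restrict hT N.satRel_monotone f j hy).map i j hf'

/-- Only the lifting condition has content. Atoms transfer because they are formulas, and
monotonicity is inherited from satisfaction. -/
lemma ModallyStronger.isSimulation (hT : PreservesExactSquares T) {M N : PointedModel T At}
    (h : ModallyStronger N M) :
    IsSimulation N M (ModallyStrongerAt N.toModel M.toModel) where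
  monotone _ _ _ _ h hx hy a ha := N.sat_mono hy le_rfl (h a (M.sat_mono hx le_rfl ha))
  point := h
  lift _ _ hxy := hxy.relLift hT
  atoms x y hxy p hp := (N.sat_atom y p).1 (hxy _ ((M.sat_atom x p).2 hp))

end HennessyMilner

end NablaLogic

theorem mainTheorem2 (T : PartOrd.{u} ⥤ PartOrd.{u}) [Limits.PreservesFilteredColimits T]
    (hmono : NablaLogic.LocallyMonotone T) (hexact : NablaLogic.PreservesExactSquares T)
    (hinter : NablaLogic.PreservesFiniteIntersections T)
    (At : PartOrd.{u}) (M N : NablaLogic.PointedModel T At) :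
    (NablaLogic.Simulates N M → NablaLogic.ModallyStronger N M) ∧
    (NablaLogic.ModallyStronger N M →
      NablaLogic.Simulates N M ∧
        NablaLogic.IsSimulation N M
          (NablaLogic.ModallyStrongerAt N.toModel M.toModel)) :=
  ⟨fun ⟨_, hS⟩ a => hS.sat hexact a _ _ hS.point,
    fun h => ⟨⟨_, h.isSimulation hexact⟩, h.isSimulation hexact⟩⟩
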